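/- Let $R$ be a Prüfer domain with quotient field $K$, i.e. an integral domain in which every nonzero finitely generated ideal is invertible. A \emph{semistar operation} on $R$ is a map $\star\colon I\mapsto I^\star$ from the set of $R$-submodules of $K$ to itself such that, for all $R$-submodules $I,J$ of $K$ and all $x\in K$: (1) $I\subseteq I^\star$; (2) $(I^\star)^\star=I^\star$; (3) $I\subseteq J$ implies $I^\star\subseteq J^\star$; (4) $(xI)^\star=x\cdot I^\star$. It is \emph{stable} if $(I\cap J)^\star=I^\star\cap J^\star$ for all $R$-submodules $I,J$ of $K$. The \emph{quasi-spectrum} $\mathrm{QSpec}^\star(R)$ is the set of prime ideals $P$ of $R$ with $P^\star\cap R=P$; the \emph{pseudo-spectrum} $\mathrm{PsSpec}^\star(R)$ is the set of prime ideals $P$ of $R$ such that $P^\star\cap R=R$ and $L^\star\cap R=L$ for some $P$-primary ideal $L$ of $R$. The \emph{normalized stable version} $\widehat{\star}$ of $\star$ is the semistar operation on $R$ defined by $$I^{\widehat{\star}}:=\bigcap_{P\in\mathrm{QSpec}^\star(R)}IR_P\ \cap\bigcap_{P\in\mathrm{PsSpec}^\star(R)}(IR_P)^{v_{R_P}}$$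 for every $R$-submodule $I$ of $K$, where $J^{v_{R_P}}:=(R_P:(R_P:J))$ and $(A:B):=\{x\in K\mid xB\subseteq A\}$ for $R$-submodules $A,B$ of $K$. Suppose that every proper ideal of $R$ has only finitely many minimal primes. Then $\star=\widehat{\star}$ for every stable semistar operation $\star$ on $R$. -/

import Mathlib

open scoped nonZeroDivisors Pointwise

/-- A Prüfer domain: an integral domain in which every nonzero finitely generated ideal is
invertible (as a fractional ideal). -/
class IsPruferDomain (R : Type*) [CommRing R] : Prop extends IsDomain R where
  isUnit_of_fg : ∀ I : Ideal R, I.FG → I ≠ ⊥ →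
    IsUnit (I : FractionalIdeal R⁰ (FractionRing R))

/-- A semistar operation on an integral domain `R` with quotient field `K`: a closure operator
`I ↦ I^⋆` on the `R`-submodules of `K` with `(xI)^⋆ = x I^⋆` for every `x ∈ K`. -/
structure SemistarOperation (R K : Type*) [CommRing R] [Field K] [Algebra R K] extends
    ClosureOperator (Submodule R K) where
  map_smul' : ∀ (x : K) (I : Submodule R K), toFun (x • I) = x • toFun I

namespace SemistarOperation

section Basic

variable {R K : Type*} [CommRing R] [Field K] [Algebra R K]

instance : CoeFun (SemistarOperation R K) (fun _ => Submodule R K → Submodule R K) :=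
  ⟨fun star => star.toFun⟩

theorem ext {s t : SemistarOperation R K} (h : ∀ I, s I = t I) : s = t := by
  obtain ⟨s, _⟩ := s
  obtain ⟨t, _⟩ := t
  obtain rfl : s = t := ClosureOperator.ext s t h
  rfl

/-- `⋆` is stable if it distributes over intersections of two submodules. -/
def IsStable (star : SemistarOperation R K) : Prop :=
  ∀ I J : Submodule R K, star (I ⊓ J) = star I ⊓ star J

/-- For an ideal `I` of `R`, the ideal `I^⋆ ∩ R` of `R`. -/
def quasiClosure (star : SemistarOperation R K) (I : Ideal R) : Ideal R :=
  (star (IsLocalization.coeSubmodule K I)).comap (Algebra.linearMap R K)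

/-- The quasi-spectrum of `⋆`: the primes `P` of `R` with `P^⋆ ∩ R = P`. -/
def qSpec (star : SemistarOperation R K) : Set (PrimeSpectrum R) :=
  {P | star.quasiClosure P.asIdeal = P.asIdeal}

/-- The pseudo-spectrum of `⋆`: the primes `P` of `R` with `P^⋆ ∩ R = R` such that
`L^⋆ ∩ R = L` for some `P`-primary ideal `L` of `R`. -/
def psSpec (star : SemistarOperation R K) : Set (PrimeSpectrum R) :=
  {P | star.quasiClosure P.asIdeal = ⊤ ∧
    ∃ L : Ideal R, L.IsPrimary ∧ L.radical = P.asIdeal ∧ star.quasiClosure L = L}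

theorem mul_mem_smul_mul {x y : K} {I A : Submodule R K} (h : y ∈ I * A) :
    x * y ∈ (x • I) * A := by
  refine Submodule.mul_induction_on h (fun i hi a ha => ?_) (fun u v hu hv => ?_)
  · rw [← mul_assoc]
    exact Submodule.mul_mem_mul (Submodule.smul_mem_pointwise_smul i x I hi) ha
  · rw [mul_add]
    exact add_mem hu hv

theorem zero_smul_submodule (I : Submodule R K) : (0 : K) • I = ⊥ := by
  refine (Submodule.eq_bot_iff _).2 fun y hy => ?_
  obtain ⟨z, -, rfl⟩ := (Submodule.mem_smul_pointwise_iff_exists _ _ _).1 hy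
  exact zero_smul K z

end Basic

section Normalized

variable {R K : Type*} [CommRing R] [IsDomain R] [Field K] [Algebra R K] [IsFractionRing R K]

variable (K) in
/-- The localization `R_P`, as an `R`-submodule of `K`. -/
noncomputable def locAt (P : PrimeSpectrum R) : Submodule R K :=
  Subalgebra.toSubmodule
    (Localization.subalgebra.ofField K P.asIdeal.primeCompl P.asIdeal.primeCompl_le_nonZeroDivisors)

/-- The `v`-operation of `R_P`, `J ↦ (R_P : (R_P : J))`, where `(A : B) = {x ∈ K | x B ⊆ A}`. -/
noncomputable def vAt (P : PrimeSpectrum R) (J : Submodule R K) : Submodule R K :=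
  locAt K P / (locAt K P / J)

/-- The map `I ↦ ⋂_{P ∈ QSpec} I R_P ∩ ⋂_{P ∈ PsSpec} (I R_P)^{v_{R_P}}`. -/
noncomputable def normalizedFun (star : SemistarOperation R K) (I : Submodule R K) :
    Submodule R K :=
  (⨅ P ∈ star.qSpec, I * locAt K P) ⊓ ⨅ P ∈ star.psSpec, vAt P (I * locAt K P)

theorem one_mem_locAt (P : PrimeSpectrum R) : (1 : K) ∈ locAt K P :=
  one_mem (Localization.subalgebra.ofField K P.asIdeal.primeCompl
    P.asIdeal.primeCompl_le_nonZeroDivisors)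

theorem locAt_mul_self (P : PrimeSpectrum R) : locAt K P * locAt K P = locAt K P :=
  Subalgebra.isIdempotentElem_toSubmodule _

theorem le_vAt (P : PrimeSpectrum R) (J : Submodule R K) : J ≤ vAt P J := by
  intro x hx
  refine Submodule.mem_div_iff_forall_mul_mem.2 fun y hy => ?_
  rw [mul_comm]
  exact Submodule.mem_div_iff_forall_mul_mem.1 hy x hx

theorem vAt_mono (P : PrimeSpectrum R) {J J' : Submodule R K} (h : J ≤ J') :
    vAt P J ≤ vAt P J' := by
  intro x hx
  refine Submodule.mem_div_iff_forall_mul_mem.2 fun y hy => ?_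
  refine Submodule.mem_div_iff_forall_mul_mem.1 hx y ?_
  exact Submodule.mem_div_iff_forall_mul_mem.2 fun z hz =>
    Submodule.mem_div_iff_forall_mul_mem.1 hy z (h hz)

theorem vAt_vAt_le (P : PrimeSpectrum R) (J : Submodule R K) : vAt P (vAt P J) ≤ vAt P J := by
  intro x hx
  refine Submodule.mem_div_iff_forall_mul_mem.2 fun y hy => ?_
  refine Submodule.mem_div_iff_forall_mul_mem.1 hx y ?_
  refine Submodule.mem_div_iff_forall_mul_mem.2 fun z hz => ?_
  rw [mul_comm]
  exact Submodule.mem_div_iff_forall_mul_mem.1 hz y hy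

theorem vAt_mul_locAt_le (P : PrimeSpectrum R) (J : Submodule R K) :
    vAt P J * locAt K P ≤ vAt P J := by
  refine Submodule.mul_le.2 fun x hx a ha => ?_
  refine Submodule.mem_div_iff_forall_mul_mem.2 fun y hy => ?_
  have h := Submodule.mul_mem_mul (Submodule.mem_div_iff_forall_mul_mem.1 hx y hy) ha
  rw [locAt_mul_self] at h
  rwa [mul_right_comm]

theorem mul_mem_vAt {P : PrimeSpectrum R} {x y : K} {I : Submodule R K}
    (h : y ∈ vAt P (I * locAt K P)) : x * y ∈ vAt P ((x • I) * locAt K P) := by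
  refine Submodule.mem_div_iff_forall_mul_mem.2 fun z hz => ?_
  have hz' : x * z ∈ locAt K P / (I * locAt K P) := by
    refine Submodule.mem_div_iff_forall_mul_mem.2 fun w hw => ?_
    have := Submodule.mem_div_iff_forall_mul_mem.1 hz _ (mul_mem_smul_mul (x := x) hw)
    rwa [show x * z * w = z * (x * w) by ring]
  have := Submodule.mem_div_iff_forall_mul_mem.1 h _ hz'
  rwa [show x * y * z = y * (x * z) by ring]

theorem mem_normalizedFun {star : SemistarOperation R K} {I : Submodule R K} {x : K} :
    x ∈ star.normalizedFun I ↔ (∀ P ∈ star.qSpec, x ∈ I * locAt K P) ∧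
      ∀ P ∈ star.psSpec, x ∈ vAt P (I * locAt K P) := by
  simp [normalizedFun, Submodule.mem_iInf]

theorem normalizedFun_mono (star : SemistarOperation R K) : Monotone star.normalizedFun := by
  intro I J h x hx
  rw [mem_normalizedFun] at hx ⊢
  have hP (P : PrimeSpectrum R) : I * locAt K P ≤ J * locAt K P := mul_le_mul' h le_rfl
  exact ⟨fun P p => hP P (hx.1 P p), fun P p => vAt_mono P (hP P) (hx.2 P p)⟩

theorem le_mul_locAt (P : PrimeSpectrum R) (I : Submodule R K) : I ≤ I * locAt K P := by
  intro x hx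
  simpa using Submodule.mul_mem_mul hx (one_mem_locAt (K := K) P)

theorem le_normalizedFun (star : SemistarOperation R K) (I : Submodule R K) :
    I ≤ star.normalizedFun I := by
  intro x hx
  rw [mem_normalizedFun]
  exact ⟨fun P _ => le_mul_locAt P I hx, fun P _ => le_vAt P _ (le_mul_locAt P I hx)⟩

theorem normalizedFun_idem (star : SemistarOperation R K) (I : Submodule R K) :
    star.normalizedFun (star.normalizedFun I) ≤ star.normalizedFun I := by
  intro x hx
  rw [mem_normalizedFun] at hx ⊢
  refine ⟨fun P p => ?_, fun P p => ?_⟩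
  · have h : star.normalizedFun I ≤ I * locAt K P := fun y hy => (mem_normalizedFun.1 hy).1 P p
    have h' := mul_le_mul' h (le_refl (locAt K P)) (hx.1 P p)
    rwa [mul_assoc, locAt_mul_self] at h'
  · have h : star.normalizedFun I ≤ vAt P (I * locAt K P) :=
      fun y hy => (mem_normalizedFun.1 hy).2 P p
    exact vAt_vAt_le P _
      (vAt_mono P ((mul_le_mul' h le_rfl).trans (vAt_mul_locAt_le P _)) (hx.2 P p))

theorem smul_normalizedFun_le (star : SemistarOperation R K) (x : K) (I : Submodule R K) :
    x • star.normalizedFun I ≤ star.normalizedFun (x • I) := by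
  intro y hy
  obtain ⟨z, hz, rfl⟩ := (Submodule.mem_smul_pointwise_iff_exists _ _ _).1 hy
  rw [mem_normalizedFun] at hz ⊢
  exact ⟨fun P p => mul_mem_smul_mul (hz.1 P p), fun P p => mul_mem_vAt (hz.2 P p)⟩

theorem bot_mem_qSpec (star : SemistarOperation R K) :
    (⟨⊥, Ideal.isPrime_bot⟩ : PrimeSpectrum R) ∈ star.qSpec := by
  have h : star ⊥ = ⊥ := by
    have := star.map_smul' 0 ⊥
    rwa [zero_smul_submodule, zero_smul_submodule] at this
  refine (Submodule.eq_bot_iff _).2 fun y hy => ?_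
  have hy' : algebraMap R K y ∈ star (IsLocalization.coeSubmodule K (⊥ : Ideal R)) := hy
  rw [IsLocalization.coeSubmodule_bot, h, Submodule.mem_bot] at hy'
  exact (FaithfulSMul.algebraMap_eq_zero_iff R K).1 hy'

/-- The normalized stable version of `⋆`, given by
`I ↦ ⋂_{P ∈ QSpec} I R_P ∩ ⋂_{P ∈ PsSpec} (I R_P)^{v_{R_P}}`. -/
noncomputable def normalized (star : SemistarOperation R K) : SemistarOperation R K where
  toClosureOperator := ClosureOperator.mk' star.normalizedFun star.normalizedFun_mono
    star.le_normalizedFun star.normalizedFun_idem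
  map_smul' := by
    intro x I
    change star.normalizedFun (x • I) = x • star.normalizedFun I
    refine le_antisymm ?_ (star.smul_normalizedFun_le x I)
    by_cases hx : x = 0
    · subst hx
      rw [zero_smul_submodule, zero_smul_submodule]
      intro y hy
      have := (mem_normalizedFun.1 hy).1 _ star.bot_mem_qSpec
      rwa [Submodule.bot_mul] at this
    · intro y hy
      have := star.smul_normalizedFun_le x⁻¹ (x • I)
        (Submodule.smul_mem_pointwise_smul y x⁻¹ _ hy)
      rw [inv_smul_smul₀ hx] at this
      have h := Submodule.smul_mem_pointwise_smul _ x _ this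
      rwa [smul_inv_smul₀ hx] at h

theorem normalized_apply (star : SemistarOperation R K) (I : Submodule R K) :
    star.normalized I =
      (⨅ P ∈ star.qSpec, I * locAt K P) ⊓ ⨅ P ∈ star.psSpec, vAt P (I * locAt K P) :=
  rfl

end Normalized

end SemistarOperation

open IsLocalization (coeSubmodule)

/-! Call an ideal dense if its closure contains `1`. By stability `x ∈ I^⋆` exactly when `(I : x)`
is dense (`mem_star_iff`), so everything reduces to dense ideals.

`⋆ ≤ ⋆̂`: for `P` in the quasi-spectrum a dense ideal cannot lie in `P`; for `P` in the
pseudo-spectrum `R_P` is closed (`star_locAt_le`), hence so is every `(R_P : B)`.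

`⋆̂ ≤ ⋆`: if `x ∉ I^⋆`, let `J` be the proper closed ideal `(I : x)^⋆ ∩ R`. If `J` lies in no prime
of the quasi-spectrum, all its minimal primes are dense and, being finitely many, so is `rad J`. As
`rad J · ⋂ (J R_P ∩ R) ⊆ J` in a Prüfer domain, some `J R_P ∩ R` is not dense; its closure is
`P`-primary, so `P` is in the pseudo-spectrum. Since `R_P` is a valuation ring, any `m ∈ P` outside
`J R_P ∩ R` shows `x ∉ (I R_P)^v`. -/

theorem IsPruferDomain.exists_mul_eq_mul {R : Type*} [CommRing R] [IsPruferDomain R] (a b : R) :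
    ∃ c d e f : R, c + d = 1 ∧ c * b = e * a ∧ d * a = f * b := by
  by_cases hab : a = 0 ∧ b = 0
  · obtain ⟨rfl, rfl⟩ := hab
    exact ⟨1, 0, 0, 0, by simp, by simp, by simp⟩
  set F := FractionRing R
  have hI : Ideal.span {a, b} ≠ ⊥ := by
    rw [Ne, Ideal.span_eq_bot]
    intro h
    exact hab ⟨h a (by simp), h b (by simp)⟩
  obtain ⟨J, hJ⟩ := isUnit_iff_exists_inv.1
    (IsPruferDomain.isUnit_of_fg _ (Submodule.fg_span (Set.toFinite _)) hI)
  have key : ∀ z ∈ ((Ideal.span {a, b} : Ideal R) : FractionalIdeal R⁰ F) * J,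
      ∃ u ∈ J, ∃ v ∈ J, z = algebraMap R F a * u + algebraMap R F b * v := by
    intro z hz
    refine FractionalIdeal.mul_induction_on hz ?_ ?_
    · intro i hi j hj
      obtain ⟨r, hr, rfl⟩ := (FractionalIdeal.mem_coeIdeal _).1 hi
      obtain ⟨x, y, rfl⟩ := Ideal.mem_span_pair.1 hr
      refine ⟨x • j, J.val.smul_mem x hj, y • j, J.val.smul_mem y hj, ?_⟩
      simp only [Algebra.smul_def, map_add, map_mul]
      ring
    · rintro _ _ ⟨u, hu, v, hv, rfl⟩ ⟨u', hu', v', hv', rfl⟩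
      exact ⟨u + u', J.val.add_mem hu hu', v + v', J.val.add_mem hv hv', by ring⟩
  have hint : ∀ r ∈ Ideal.span {a, b}, ∀ u ∈ J, ∃ t : R,
      algebraMap R F t = algebraMap R F r * u := by
    intro r hr u hu
    have := FractionalIdeal.mul_mem_mul (FractionalIdeal.mem_coeIdeal_of_mem R⁰ (P := F) hr) hu
    rw [hJ] at this
    exact (FractionalIdeal.mem_one_iff _).1 this
  obtain ⟨u, hu, v, hv, huv⟩ := key 1 (by rw [hJ]; exact FractionalIdeal.one_mem_one _)
  have ha : a ∈ Ideal.span {a, b} := Ideal.subset_span (by simp)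
  have hb : b ∈ Ideal.span {a, b} := Ideal.subset_span (by simp)
  -- With `1 = a u + b v`, take `c = a u`, `d = b v`, `e = b u`, `f = a v`; all lie in `R` because
  -- `(a, b) J = R`.
  obtain ⟨c, hc⟩ := hint a ha u hu
  obtain ⟨d, hd⟩ := hint b hb v hv
  obtain ⟨e, he⟩ := hint b hb u hu
  obtain ⟨f, hf⟩ := hint a ha v hv
  refine ⟨c, d, e, f, ?_, ?_, ?_⟩ <;> apply IsFractionRing.injective R F
  · rw [map_add, hc, hd, ← huv, map_one]
  · rw [map_mul, map_mul, hc, he]; ring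
  · rw [map_mul, map_mul, hd, hf]; ring

/-- Localizations of Prüfer domains at primes are valuation rings. -/
theorem IsPruferDomain.exists_notMem_mul_eq_mul {R : Type*} [CommRing R] [IsPruferDomain R]
    (P : Ideal R) [P.IsPrime] (a b : R) :
    ∃ s ∉ P, ∃ c, s * a = c * b ∨ s * b = c * a := by
  obtain ⟨c, d, e, f, h1, h2, h3⟩ := exists_mul_eq_mul a b
  by_cases hc : c ∈ P
  · refine ⟨d, fun hd => ?_, f, Or.inl h3⟩
    exact (Ideal.ne_top_iff_one P).1 ‹P.IsPrime›.ne_top (h1 ▸ P.add_mem hc hd)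
  · exact ⟨c, hc, e, Or.inr h2⟩

/-! ### Contractions of localized ideals -/

namespace Ideal

variable {R : Type*} [CommRing R]

/-- The contraction `I R_P ∩ R` of the extension of `I` to the localization at `P`. -/
def saturationAt (P : Ideal R) [hP : P.IsPrime] (I : Ideal R) : Ideal R where
  carrier := {r | ∃ s ∉ P, s * r ∈ I}
  zero_mem' := ⟨1, (Ideal.ne_top_iff_one P).1 hP.ne_top, by simp⟩
  add_mem' := by
    rintro a b ⟨s, hs, ha⟩ ⟨t, ht, hb⟩
    refine ⟨s * t, hP.mul_notMem hs ht, ?_⟩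
    rw [show s * t * (a + b) = t * (s * a) + s * (t * b) by ring]
    exact I.add_mem (I.mul_mem_left _ ha) (I.mul_mem_left _ hb)
  smul_mem' := by
    rintro c a ⟨s, hs, ha⟩
    refine ⟨s, hs, ?_⟩
    rw [smul_eq_mul, mul_left_comm]
    exact I.mul_mem_left _ ha

theorem mem_saturationAt {P : Ideal R} [P.IsPrime] {I : Ideal R} {r : R} :
    r ∈ saturationAt P I ↔ ∃ s ∉ P, s * r ∈ I :=
  Iff.rfl

theorem mem_saturationAt_of_mul_mem {P : Ideal R} [hP : P.IsPrime] {I : Ideal R} {s r : R}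
    (hs : s ∉ P) (h : s * r ∈ saturationAt P I) : r ∈ saturationAt P I := by
  obtain ⟨t, ht, h⟩ := h
  exact ⟨t * s, hP.mul_notMem ht hs, by rwa [mul_assoc]⟩

/-- When `P` is minimal over `J`, the only prime of `R_P` above `J R_P` is the maximal one. -/
theorem le_radical_saturationAt {P : Ideal R} [P.IsPrime] {J : Ideal R}
    (hP : P ∈ J.minimalPrimes) : P ≤ (saturationAt P J).radical := by
  intro y hy
  have h := Ideal.mem_map_of_mem (algebraMap R (Localization.AtPrime P)) hy
  rw [← IsLocalization.AtPrime.radical_map_of_mem_minimalPrimes _ P J hP] at h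
  obtain ⟨n, hn⟩ := h
  rw [← map_pow, IsLocalization.algebraMap_mem_map_algebraMap_iff P.primeCompl] at hn
  exact ⟨n, hn⟩

/-- Check locally at a maximal `Q ⊇ (J : yx)`, with `P ⊆ Q` minimal over `J` and `s x ∈ J`, `s ∉ P`.
In the valuation ring `R_Q`, `y ∈ P` cannot divide `s ∉ P`, so `s` divides `y` and `y x ∈ J R_Q`. -/
theorem mul_mem_of_mem_radical_of_forall_mem_saturationAt [IsPruferDomain R] {J : Ideal R} {x y : R}
    (hx : ∀ P (hP : P ∈ J.minimalPrimes), x ∈ @saturationAt R _ P hP.1.1 J)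
    (hy : y ∈ J.radical) : y * x ∈ J := by
  by_contra hyx
  have hne : Submodule.comap (LinearMap.toSpanSingleton R R (y * x)) J ≠ ⊤ := fun h =>
    hyx (by simpa using (Ideal.eq_top_iff_one _).1 h)
  obtain ⟨Q, hQ, hle⟩ := Ideal.exists_le_maximal _ hne
  have hQ' := hQ.isPrime
  have hmem : ∀ t, t * (y * x) ∈ J → t ∈ Q := fun t ht => hle (by simpa using ht)
  have hJQ : J ≤ Q := fun t ht => hmem t (J.mul_mem_right _ ht)
  obtain ⟨P, hP, hPQ⟩ := Ideal.exists_minimalPrimes_le hJQ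
  have hP' := hP.1.1
  obtain ⟨s, hs, hsx⟩ := hx P hP
  have hyP : y ∈ P := by
    rw [← Ideal.sInf_minimalPrimes] at hy
    exact Ideal.mem_sInf.1 hy hP
  obtain ⟨t, ht, c, h | h⟩ := IsPruferDomain.exists_notMem_mul_eq_mul Q y s
  · refine ht (hmem t ?_)
    rw [← mul_assoc, h, mul_assoc]
    exact J.mul_mem_left _ hsx
  · refine hP'.mul_notMem (fun h' => ht (hPQ h')) hs ?_
    rw [h]
    exact P.mul_mem_left _ hyP

end Ideal

namespace SemistarOperation

/-! ### Stable operations and dense ideals -/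

section Basic

variable {R K : Type*} [CommRing R] [Field K] [Algebra R K] (star : SemistarOperation R K)

theorem le_star (I : Submodule R K) : I ≤ star I :=
  star.toClosureOperator.le_closure I

theorem star_mono {I J : Submodule R K} (h : I ≤ J) : star I ≤ star J :=
  star.toClosureOperator.monotone h

theorem star_le {I J : Submodule R K} (h : I ≤ star J) : star I ≤ star J :=
  star.toClosureOperator.le_closure_iff.1 h

theorem mul_mem_star {I J : Submodule R K} {x y : K} (hx : x ∈ star I) (hy : y ∈ star J) :
    x * y ∈ star (I * J) := by
  have h1 : ∀ b ∈ J, b • star I ≤ star (I * J) := fun b hb => by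
    rw [← star.map_smul']
    refine star.star_mono fun z hz => ?_
    obtain ⟨w, hw, rfl⟩ := (Submodule.mem_smul_pointwise_iff_exists _ _ _).1 hz
    rw [smul_eq_mul, mul_comm b]
    exact Submodule.mul_mem_mul hw hb
  have h2 : x • star J ≤ star (I * J) := by
    rw [← star.map_smul']
    refine star.star_le fun z hz => ?_
    obtain ⟨w, hw, rfl⟩ := (Submodule.mem_smul_pointwise_iff_exists _ _ _).1 hz
    rw [smul_eq_mul, mul_comm x]
    exact h1 w hw (Submodule.smul_mem_pointwise_smul x w _ hx)
  exact h2 (Submodule.smul_mem_pointwise_smul y x _ hy)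

theorem mem_quasiClosure {I : Ideal R} {r : R} :
    r ∈ star.quasiClosure I ↔ algebraMap R K r ∈ star (coeSubmodule K I) :=
  Iff.rfl

theorem le_quasiClosure (I : Ideal R) : I ≤ star.quasiClosure I :=
  fun r hr => star.le_star _ ⟨r, hr, rfl⟩

theorem quasiClosure_mono {I J : Ideal R} (h : I ≤ J) :
    star.quasiClosure I ≤ star.quasiClosure J :=
  fun _ hr => star.star_mono (Submodule.map_mono h) hr

theorem quasiClosure_idem (I : Ideal R) :
    star.quasiClosure (star.quasiClosure I) = star.quasiClosure I := by
  refine le_antisymm (fun r hr => star.star_le ?_ hr) (star.le_quasiClosure _)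
  rintro _ ⟨s, hs, rfl⟩
  exact hs

theorem quasiClosure_eq_top_iff {I : Ideal R} :
    star.quasiClosure I = ⊤ ↔ (1 : K) ∈ star (coeSubmodule K I) := by
  rw [Ideal.eq_top_iff_one, mem_quasiClosure, map_one]

theorem quasiClosure_top : star.quasiClosure (⊤ : Ideal R) = ⊤ :=
  top_le_iff.1 (star.le_quasiClosure _)

/-- The ideal `{r ∈ R | r x ∈ I}`. -/
def denom (I : Submodule R K) (x : K) : Ideal R :=
  I.comap (LinearMap.toSpanSingleton R K x)

theorem mem_denom {I : Submodule R K} {x : K} {r : R} :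
    r ∈ denom I x ↔ algebraMap R K r * x ∈ I := by
  rw [← Algebra.smul_def]; exact Iff.rfl

variable {star}

/-- A stable semistar operation is determined by the ideals whose closure contains `1`. -/
theorem IsStable.mem_star_iff (hstar : star.IsStable) {I : Submodule R K} {x : K} :
    x ∈ star I ↔ star.quasiClosure (denom I x) = ⊤ := by
  rw [quasiClosure_eq_top_iff]
  by_cases hx : x = 0
  · subst hx
    refine iff_of_true (zero_mem _) (star.le_star _ ⟨1, ?_, map_one (algebraMap R K)⟩)
    change 1 ∈ denom I 0
    rw [mem_denom, mul_zero]
    exact zero_mem _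
  -- Closing this identity, stability gives `x (I : x)^⋆ = I^⋆ ∩ (Rx)^⋆`, which contains `x` iff `x
  -- ∈ I^⋆`.
  have h : x • coeSubmodule K (denom I x) = I ⊓ Submodule.span R {x} := by
    ext z
    simp only [Submodule.mem_smul_pointwise_iff_exists, Submodule.mem_inf,
      Submodule.mem_span_singleton, smul_eq_mul]
    constructor
    · rintro ⟨_, ⟨r, hr, rfl⟩, rfl⟩
      refine ⟨?_, r, ?_⟩
      · rw [mul_comm]; exact mem_denom.1 hr
      · rw [Algebra.smul_def, mul_comm]; rfl
    · rintro ⟨hz, r, rfl⟩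
      refine ⟨_, ⟨r, hz, rfl⟩, ?_⟩
      rw [Algebra.smul_def, mul_comm]; rfl
  have h' := congrArg star.toFun h
  rw [star.map_smul', hstar] at h'
  have hxx : x ∈ star (Submodule.span R {x}) :=
    star.le_star _ (Submodule.mem_span_singleton_self x)
  constructor
  · intro hxI
    have : x ∈ x • star (coeSubmodule K (denom I x)) := h' ▸ ⟨hxI, hxx⟩
    obtain ⟨y, hy, hxy⟩ := (Submodule.mem_smul_pointwise_iff_exists _ _ _).1 this
    rwa [← mul_left_cancel₀ hx (hxy.trans (mul_one x).symm)]
  · intro h1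
    have := Submodule.smul_mem_pointwise_smul _ x _ h1
    rw [h', smul_eq_mul, mul_one] at this
    exact this.1

variable [FaithfulSMul R K]

theorem denom_coeSubmodule (I : Ideal R) (r : R) :
    denom (coeSubmodule K I) (algebraMap R K r) =
      Submodule.comap (LinearMap.toSpanSingleton R R r) I := by
  ext t
  rw [mem_denom, ← map_mul, IsLocalization.mem_coeSubmodule]
  constructor
  · rintro ⟨y, hy, h⟩
    rw [FaithfulSMul.algebraMap_injective R K h] at hy
    exact hy
  · exact fun h => ⟨_, h, rfl⟩

theorem IsStable.mem_quasiClosure_iff (hstar : star.IsStable) {I : Ideal R} {r : R} :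
    r ∈ star.quasiClosure I ↔
      star.quasiClosure (Submodule.comap (LinearMap.toSpanSingleton R R r) I) = ⊤ := by
  rw [mem_quasiClosure, hstar.mem_star_iff, denom_coeSubmodule]

theorem IsStable.quasiClosure_inf (hstar : star.IsStable) (I J : Ideal R) :
    star.quasiClosure (I ⊓ J) = star.quasiClosure I ⊓ star.quasiClosure J := by
  rw [quasiClosure, IsLocalization.coeSubmodule,
    Submodule.map_inf _ (FaithfulSMul.algebraMap_injective R K), hstar]
  rfl

theorem IsStable.quasiClosure_sInf_eq_top (hstar : star.IsStable) {S : Set (Ideal R)}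
    (hS : S.Finite) (h : ∀ I ∈ S, star.quasiClosure I = ⊤) : star.quasiClosure (sInf S) = ⊤ := by
  induction S, hS using Set.Finite.induction_on with
  | empty => rw [sInf_empty, quasiClosure_top]
  | insert _ _ ih =>
    rw [sInf_insert, hstar.quasiClosure_inf, h _ (Set.mem_insert _ _),
      ih fun I hI => h I (Set.mem_insert_of_mem _ hI), inf_top_eq]

/-- For `r ∉ P` in the closure, `(P : r)` is dense, yet primality gives `(P : r) ⊆ P`. -/
theorem IsStable.quasiClosure_prime (hstar : star.IsStable) {P : Ideal R} (hP : P.IsPrime) :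
    star.quasiClosure P = P ∨ star.quasiClosure P = ⊤ := by
  refine or_iff_not_imp_left.2 fun h => ?_
  obtain ⟨r, hr, hrP⟩ := Set.not_subset.1 fun h' => h (le_antisymm h' (star.le_quasiClosure P))
  have h1 := hstar.mem_quasiClosure_iff.1 hr
  refine top_le_iff.1 (h1.symm.le.trans (star.quasiClosure_mono fun t ht => ?_))
  exact (hP.mem_or_mem (show t * r ∈ P from ht)).resolve_right hrP

theorem IsStable.mem_quasiClosure_of_mul_mem (hstar : star.IsStable) {P L : Ideal R}
    (hL : ∀ s ∉ P, ∀ r, s * r ∈ L → r ∈ L) {s r : R} (hs : s ∉ P)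
    (h : s * r ∈ star.quasiClosure L) : r ∈ star.quasiClosure L := by
  rw [hstar.mem_quasiClosure_iff] at h ⊢
  refine top_le_iff.1 (h.symm.le.trans (star.quasiClosure_mono fun t ht => ?_))
  refine hL s hs _ ?_
  have : t * (s * r) ∈ L := ht
  change s * (t * r) ∈ L
  rwa [mul_left_comm]

theorem algebraMap_ne_zero_of_notMem {P : PrimeSpectrum R} {s : R} (hs : s ∉ P.asIdeal) :
    algebraMap R K s ≠ 0 :=
  fun h => hs (by rw [(FaithfulSMul.algebraMap_eq_zero_iff R K).1 h]; exact zero_mem _)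

/-- If `P` is minimal over `J` and `P`, but not `J R_P ∩ R`, has dense closure, then `P` lies in
the pseudo-spectrum. -/
theorem IsStable.mem_psSpec (hstar : star.IsStable) {J : Ideal R} {P : PrimeSpectrum R}
    (hPJ : P.asIdeal ∈ J.minimalPrimes) (hP : star.quasiClosure P.asIdeal = ⊤)
    (h : star.quasiClosure (Ideal.saturationAt P.asIdeal J) ≠ ⊤) : P ∈ star.psSpec := by
  set L := star.quasiClosure (Ideal.saturationAt P.asIdeal J)
  have hsat : ∀ s ∉ P.asIdeal, ∀ r, s * r ∈ L → r ∈ L := fun s hs r =>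
    hstar.mem_quasiClosure_of_mul_mem
      (fun s hs r => Ideal.mem_saturationAt_of_mul_mem hs) hs
  have hLP : L ≤ P.asIdeal := fun s hs => by
    by_contra hsP
    exact h ((Ideal.eq_top_iff_one _).2 (hsat s hsP 1 (by rwa [mul_one])))
  have hrad : L.radical = P.asIdeal := by
    refine le_antisymm (P.isPrime.radical_le_iff.2 hLP) fun y hy => ?_
    obtain ⟨n, hn⟩ := Ideal.le_radical_saturationAt hPJ hy
    exact ⟨n, star.le_quasiClosure _ hn⟩
  refine ⟨hP, L, Ideal.isPrimary_iff.2 ⟨h, fun {x y} hxy => ?_⟩, hrad, star.quasiClosure_idem _⟩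
  rw [hrad, or_iff_not_imp_right]
  exact fun hy => hsat y hy x (by rwa [mul_comm])

end Basic

/-! ### Membership in localizations -/

section Prufer

variable {R K : Type*} [CommRing R] [IsDomain R] [Field K] [Algebra R K] [IsFractionRing R K]

theorem mem_locAt {P : PrimeSpectrum R} {x : K} :
    x ∈ locAt K P ↔ ∃ a, ∃ s ∉ P.asIdeal, algebraMap R K s * x = algebraMap R K a := by
  constructor
  · rintro ⟨a, s, hs, rfl⟩
    refine ⟨a, s, hs, ?_⟩
    rw [mul_left_comm, mul_inv_cancel₀ (algebraMap_ne_zero_of_notMem hs), mul_one]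
  · rintro ⟨a, s, hs, h⟩
    exact ⟨a, s, hs, by
      rw [← h, mul_comm, inv_mul_cancel_left₀ (algebraMap_ne_zero_of_notMem hs)]⟩

theorem mem_mul_locAt {P : PrimeSpectrum R} {I : Submodule R K} {x : K} :
    x ∈ I * locAt K P ↔ ∃ s ∉ P.asIdeal, algebraMap R K s * x ∈ I := by
  constructor
  · intro h
    refine Submodule.mul_induction_on h ?_ ?_
    · intro i hi v hv
      obtain ⟨a, s, hs, h⟩ := mem_locAt.1 hv
      refine ⟨s, hs, ?_⟩
      rw [mul_left_comm, h, mul_comm, ← Algebra.smul_def]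
      exact I.smul_mem _ hi
    · rintro x y ⟨s, hs, hx⟩ ⟨t, ht, hy⟩
      refine ⟨s * t, P.isPrime.mul_notMem hs ht, ?_⟩
      have := I.add_mem (I.smul_mem t hx) (I.smul_mem s hy)
      simp only [Algebra.smul_def] at this
      rw [map_mul]
      convert! this using 1
      ring
  · rintro ⟨s, hs, h⟩
    have : (algebraMap R K s)⁻¹ ∈ locAt K P :=
      mem_locAt.2 ⟨1, s, hs, by rw [mul_inv_cancel₀ (algebraMap_ne_zero_of_notMem hs), map_one]⟩
    have := Submodule.mul_mem_mul h this
    rwa [mul_right_comm, mul_inv_cancel₀ (algebraMap_ne_zero_of_notMem hs), one_mul] at this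

end Prufer

/-! ### Comparison of the two operations -/

section Main

variable {R K : Type*} [CommRing R] [IsPruferDomain R] [Field K] [Algebra R K]
  [IsFractionRing R K] {star : SemistarOperation R K}

theorem mem_locAt_or (P : PrimeSpectrum R) (x : K) :
    x ∈ locAt K P ∨ ∃ m ∈ P.asIdeal, ∃ s ∉ P.asIdeal,
      algebraMap R K m * x = algebraMap R K s := by
  obtain ⟨a, b, hb, rfl⟩ := IsFractionRing.div_surjective R x
  have hb' : algebraMap R K b ≠ 0 := IsFractionRing.to_map_ne_zero_of_mem_nonZeroDivisors hb
  obtain ⟨s, hs, c, h | h⟩ := IsPruferDomain.exists_notMem_mul_eq_mul P.asIdeal a b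
  · refine Or.inl (mem_locAt.2 ⟨c, s, hs, ?_⟩)
    rw [← mul_div_assoc, ← map_mul, h, map_mul, mul_div_cancel_right₀ _ hb']
  · have hcs : algebraMap R K c * (algebraMap R K a / algebraMap R K b) = algebraMap R K s := by
      rw [← mul_div_assoc, ← map_mul, ← h, map_mul, mul_div_cancel_right₀ _ hb']
    by_cases hc : c ∈ P.asIdeal
    · exact Or.inr ⟨c, hc, s, hs, hcs⟩
    · exact Or.inl (mem_locAt.2 ⟨s, c, hc, hcs⟩)

/-- For `P` in the pseudo-spectrum, the localization `R_P` is closed. -/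
theorem IsStable.star_locAt_le (hstar : star.IsStable) {P : PrimeSpectrum R}
    (hP : P ∈ star.psSpec) : star (locAt K P) ≤ locAt K P := by
  intro x hx
  refine (mem_locAt_or P x).resolve_right ?_
  rintro ⟨m, hm, s, hs, hms⟩
  obtain ⟨-, L, hL, hrad, hLcl⟩ := hP
  obtain ⟨n, hn⟩ : m ∈ L.radical := hrad ▸ hm
  have hpow : ∀ k : ℕ, x ^ k ∈ star (locAt K P) := fun k => by
    induction k with
    | zero => rw [pow_zero]; exact star.le_star _ (one_mem_locAt P)
    | succ k ih => rw [pow_succ, ← locAt_mul_self]; exact star.mul_mem_star ih hx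
  -- Since `m x = s`, this element is `s ^ n`. As `s ∉ P`, `(L R_P : s ^ n) ⊆ L`, so `L` would be
  -- dense, though it is closed and proper.
  have h1 : algebraMap R K (m ^ n) * x ^ n ∈ star (coeSubmodule K L * locAt K P) :=
    star.mul_mem_star (star.le_star _ ⟨_, hn, rfl⟩) (hpow n)
  rw [map_pow, ← mul_pow, hms, ← map_pow, hstar.mem_star_iff] at h1
  refine (Ideal.isPrimary_iff.1 hL).1 (top_le_iff.1 ?_)
  rw [← h1, ← hLcl]
  refine star.quasiClosure_mono fun r hr => ?_
  rw [hLcl] at hr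
  rw [mem_denom, mem_mul_locAt] at hr
  obtain ⟨t, ht, y, hy, h⟩ := hr
  rw [Algebra.linearMap_apply, ← map_mul, ← map_mul] at h
  rw [FaithfulSMul.algebraMap_injective R K h] at hy
  rw [show t * (r * s ^ n) = r * (t * s ^ n) by ring] at hy
  refine ((Ideal.isPrimary_iff.1 hL).2 hy).resolve_right fun h' => ?_
  rw [hrad] at h'
  exact P.isPrime.mul_notMem ht (fun h => hs (P.isPrime.mem_of_pow_mem _ h)) h'

theorem IsStable.le_normalized (hstar : star.IsStable) (I : Submodule R K) :
    star I ≤ star.normalized I := by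
  intro x hx
  refine mem_normalizedFun.2 ⟨fun P hP => ?_, fun P hP => ?_⟩
  · rw [mem_mul_locAt]
    by_contra! h
    have : denom I x ≤ P.asIdeal := fun r hr => by
      by_contra hrP
      exact h r hrP (mem_denom.1 hr)
    have h1 := star.quasiClosure_mono this
    rw [hstar.mem_star_iff.1 hx, show star.quasiClosure P.asIdeal = P.asIdeal from hP] at h1
    exact P.isPrime.ne_top (top_le_iff.1 h1)
  · refine Submodule.mem_div_iff_forall_mul_mem.2 fun y hy => hstar.star_locAt_le hP ?_
    have : y • I ≤ locAt K P := fun z hz => by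
      obtain ⟨w, hw, rfl⟩ := (Submodule.mem_smul_pointwise_iff_exists _ _ _).1 hz
      exact Submodule.mem_div_iff_forall_mul_mem.1 hy w (le_mul_locAt P I hw)
    refine star.star_mono this ?_
    rw [star.map_smul', mul_comm]
    exact Submodule.smul_mem_pointwise_smul x y _ hx

/-- Finiteness is needed because stability preserves density only under finite intersections. -/
theorem IsStable.exists_mem_qSpec_or_psSpec (hstar : star.IsStable) {J : Ideal R}
    (hfin : J.minimalPrimes.Finite) (hJ : star.quasiClosure J = J) (hne : J ≠ ⊤) :
    (∃ P ∈ star.qSpec, J ≤ P.asIdeal) ∨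
      ∃ P ∈ star.psSpec, ∃ m ∈ P.asIdeal, m ∉ Ideal.saturationAt P.asIdeal J := by
  refine or_iff_not_imp_left.2 fun hq => ?_
  have htop : ∀ P ∈ J.minimalPrimes, star.quasiClosure P = ⊤ := fun P hP =>
    (hstar.quasiClosure_prime hP.1.1).resolve_left fun h => hq ⟨⟨P, hP.1.1⟩, h, hP.1.2⟩
  obtain ⟨P, hP, hPtop⟩ : ∃ P : PrimeSpectrum R, P.asIdeal ∈ J.minimalPrimes ∧
      star.quasiClosure (Ideal.saturationAt P.asIdeal J) ≠ ⊤ := by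
    by_contra! hall
    have hradtop : star.quasiClosure J.radical = ⊤ := by
      rw [← Ideal.sInf_minimalPrimes]
      exact hstar.quasiClosure_sInf_eq_top hfin htop
    let S : Set (Ideal R) := {I | ∃ P : PrimeSpectrum R, P.asIdeal ∈ J.minimalPrimes ∧
      Ideal.saturationAt P.asIdeal J = I}
    have hSfin : S.Finite :=
      (hfin.preimage (Function.Injective.injOn fun _ _ => PrimeSpectrum.ext)).image
        fun P : PrimeSpectrum R => Ideal.saturationAt P.asIdeal J
    have hStop : star.quasiClosure (sInf S) = ⊤ :=
      hstar.quasiClosure_sInf_eq_top hSfin (by rintro _ ⟨P, hP, rfl⟩; exact hall P hP)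
    have hSJ : sInf S ≤ J := fun x hx => by
      -- It suffices that `(J : x)` is dense; it contains the dense ideal `rad J`.
      rw [← hJ, hstar.mem_quasiClosure_iff, ← top_le_iff, ← hradtop]
      refine star.quasiClosure_mono fun y hy => ?_
      exact Ideal.mul_mem_of_mem_radical_of_forall_mem_saturationAt
        (fun P hP => Ideal.mem_sInf.1 hx ⟨⟨P, hP.1.1⟩, hP, rfl⟩) hy
    have := star.quasiClosure_mono hSJ
    rw [hStop, hJ] at this
    exact hne (top_le_iff.1 this)
  refine ⟨P, hstar.mem_psSpec hP (htop _ hP) hPtop, ?_⟩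
  by_contra! hle
  refine hPtop (top_le_iff.1 ?_)
  rw [← htop _ hP]
  exact star.quasiClosure_mono hle

theorem IsStable.normalized_le (hstar : star.IsStable)
    (hmin : ∀ I : Ideal R, I ≠ ⊤ → I.minimalPrimes.Finite) (I : Submodule R K) :
    star.normalized I ≤ star I := by
  intro x hx
  obtain ⟨hxq, hxp⟩ := mem_normalizedFun.1 hx
  by_contra hxI
  have hne : star.quasiClosure (denom I x) ≠ ⊤ := fun h => hxI (hstar.mem_star_iff.2 h)
  rcases hstar.exists_mem_qSpec_or_psSpec (hmin _ hne) (star.quasiClosure_idem _) hne with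
    ⟨P, hP, hle⟩ | ⟨P, hP, m, hmP, hm⟩
  · obtain ⟨s, hs, hsx⟩ := mem_mul_locAt.1 (hxq P hP)
    exact hs (hle (star.le_quasiClosure _ (mem_denom.2 hsx)))
  have hx0 : x ≠ 0 := by rintro rfl; exact hxI (zero_mem _)
  have hm0 : algebraMap R K m ≠ 0 := fun h => hm <| by
    rw [(FaithfulSMul.algebraMap_eq_zero_iff R K).1 h]; exact zero_mem _
  -- Otherwise `c z = s x m` for some `z ∈ I R_P`, `s ∉ P`; clearing the denominator `t` of `z` puts
  -- `t s m` in `(I : x)`, against the choice of `m`.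
  have hdiv : (x * algebraMap R K m)⁻¹ ∈ locAt K P / (I * locAt K P) := by
    refine Submodule.mem_div_iff_forall_mul_mem.2 fun z hz => ?_
    refine (mem_locAt_or P _).resolve_right ?_
    rintro ⟨c, -, s, hs, h⟩
    obtain ⟨t, ht, htz⟩ := mem_mul_locAt.1 hz
    refine hm ⟨t * s, P.isPrime.mul_notMem ht hs, star.le_quasiClosure _ (mem_denom.2 ?_)⟩
    have : algebraMap R K (t * s * m) * x = c • (algebraMap R K t * z) := by
      rw [map_mul, map_mul, ← h, Algebra.smul_def]
      field_simp
    rw [this]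
    exact I.smul_mem _ htz
  -- This puts `x (x m)⁻¹ = m⁻¹` in `R_P`, impossible for `m ∈ P`.
  have hinv := Submodule.mem_div_iff_forall_mul_mem.1 (hxp P hP) _ hdiv
  obtain ⟨a, s, hs, h⟩ := mem_locAt.1 hinv
  refine hs ?_
  have : s = a * m := by
    apply FaithfulSMul.algebraMap_injective R K
    rw [map_mul, ← h]
    field_simp
  rw [this]
  exact P.asIdeal.mul_mem_left _ hmP

end Main

end SemistarOperation

theorem mainTheorem1 {R K : Type*} [CommRing R] [IsPruferDomain R] [Field K] [Algebra R K]
    [IsFractionRing R K]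
    (hmin : ∀ I : Ideal R, I ≠ ⊤ → I.minimalPrimes.Finite)
    (star : SemistarOperation R K) (hstar : star.IsStable) :
    star = star.normalized :=
  SemistarOperation.ext fun I =>
    le_antisymm (hstar.le_normalized I) (hstar.normalized_le hmin I)
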